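/- Let $n$ be a nonnegative integer, and let $\mathbf{k}$ be a commutative ring in which $n!$ is invertible. Let $\mathcal{A}=\mathbf{k}[S_n]$ be the group algebra of the symmetric group $S_n$ of all permutations of $[n]=\{1,2,\ldots,n\}$. A *set composition* of $[n]$ of length $\ell$ is an $\ell$-tuple $\mathbf{A}=(A_1,\ldots,A_\ell)$ of disjoint nonempty subsets of $[n]$ with union $[n]$. For two set compositions $\mathbf{A},\mathbf{B}$ of $[n]$ of the same length $\ell$, let $\nabla_{\mathbf{B},\mathbf{A}}\in\mathcal{A}$ be the sum of all $w\in S_n$ such that $w(A_i)=B_i$ for all $i$. For $U\subseteq[n]$, let $\nabla_U^-=\sum_w (-1)^w w\in\mathcal{A}$, where the sum is over all $w\in S_n$ with $w(i)=i$ for all $i\in[n]\setminus U$, and $(-1)^w$ is the sign of $w$. For $k\in\mathbb{N}=\{0,1,2,\ldots\}$ define the $\mathbf{k}$-submodules $$\mathcal{I}_k=\operatorname{span}_{\mathbf{k}}\{\nabla_{\mathbf{B},\mathbf{A}}\mid \mathbf{A},\mathbf{B}\text{ set compositions of }[n]\text{ of the same length }\ell\le k\},$$ $$\mathcal{J}_k=\mathcal{A}\cdot\operatorname{span}_{\mathbf{k}}\{\nabla_U^-\mid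 U\subseteq[n],\ |U|=k+1\}\cdot\mathcal{A}$$ of $\mathcal{A}$. For each partition $\lambda$ of $n$ (written $\lambda\vdash n$), let $\ell(\lambda)$ be its length (number of parts), and let $S^\lambda$ be the corresponding Specht module, realized as the left ideal $S^\lambda=\mathcal{A}\,\mathbf{a}_T\mathbf{b}_T$ of $\mathcal{A}$, where $T$ is any chosen Young tableau of shape $\lambda$ containing each of $1,2,\ldots,n$ once, $\mathbf{a}_T$ is the sum of all $w\in S_n$ preserving each row of $T$ as a set, and $\mathbf{b}_T$ is the sum of $(-1)^w w$ over all $w\in S_n$ preserving each column of $T$ as a set. For $a\in\mathcal{A}$ let $a_\lambda\in\operatorname{End}_{\mathbf{k}}(S^\lambda)$ denote the action of $a$ on $S^\lambda$. Then the $\mathbf{k}$-algebra homomorphism $$\operatorname{AW}:\mathcal{A}\to\prod_{\lambda\vdash n}\operatorname{End}_{\mathbf{k}}(S^\lambda),\qquad a\mapsto(a_\lambda)_{\lambda\vdash n}$$ is an isomorphism. For a set $U$ of partitions of $n$, let $\mathcal{A}_U$ be the preimage under $\operatorname{AW}$ of the subproduct $\prod_{\lambda\in U}\operatorname{End}_{\mathbf{k}}(S^\lambda)$,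 i.e. of the two-sided ideal of all families whose $\lambda$-th entry is $0$ for every $\lambda\notin U$; it is a two-sided ideal of $\mathcal{A}$. Then, for every $k\in\mathbb{N}$, $$\mathcal{I}_k=\mathcal{A}_{\{\lambda\vdash n\,\mid\,\ell(\lambda)\le k\}}\qquad\text{and}\qquad \mathcal{J}_k=\mathcal{A}_{\{\lambda\vdash n\,\mid\,\ell(\lambda)>k\}}.$$ -/

import Mathlib

/-!
The group algebra of `S_n` over a commutative ring `k` is `MonoidAlgebra k (Equiv.Perm (Fin n))`;
the set `[n]` is modelled by `Fin n`.  Permutations are multiplied by composition.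
-/

namespace SymGroupAlg

/-- The group algebra `k[S_n]` of the symmetric group. -/
abbrev GrpAlg (k : Type*) [CommRing k] (n : ℕ) : Type _ :=
  MonoidAlgebra k (Equiv.Perm (Fin n))

/-! ### Row-to-row sums, antisymmetrizers and the two ideals -/

/-- A tuple `A` of `l` subsets of `[n]` is a set decomposition of `[n]` (of length `l`) if its
blocks are pairwise disjoint and their union is `[n]`. -/
structure IsSetDecomposition {n l : ℕ} (A : Fin l → Finset (Fin n)) : Prop where
  disjoint : ∀ i j : Fin l, i ≠ j → Disjoint (A i) (A j)
  union : Finset.univ.biUnion A = Finset.univ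

/-- A set composition is a set decomposition all of whose blocks are nonempty. -/
structure IsSetComposition {n l : ℕ} (A : Fin l → Finset (Fin n)) : Prop
    extends IsSetDecomposition A where
  nonempty : ∀ i : Fin l, (A i).Nonempty

/-- The row-to-row sum `∇_{B,A}`: the sum of all `w ∈ S_n` with `w(A_i) = B_i` for all `i`. -/
noncomputable def rowToRowSum (k : Type*) [CommRing k] {n l : ℕ}
    (B A : Fin l → Finset (Fin n)) : GrpAlg k n :=
  ∑ w : Equiv.Perm (Fin n) with ∀ i : Fin l, (A i).image (fun x => w x) = B i,
    MonoidAlgebra.of k _ w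

/-- The antisymmetrizer `∇_U^-`: the signed sum of all `w ∈ S_n` that fix every `i ∉ U`. -/
noncomputable def antisymmetrizer (k : Type*) [CommRing k] {n : ℕ}
    (U : Finset (Fin n)) : GrpAlg k n :=
  ∑ w : Equiv.Perm (Fin n) with ∀ i : Fin n, i ∉ U → w i = i,
    ((Equiv.Perm.sign w : ℤ) : k) • MonoidAlgebra.of k _ w

/-- `I_m`: the `k`-linear span of all row-to-row sums `∇_{B,A}`, where `A` and `B` are set
compositions of `[n]` of the same length `l ≤ m`. -/
noncomputable def idealI (k : Type*) [CommRing k] (n m : ℕ) : Submodule k (GrpAlg k n) :=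
  Submodule.span k {x | ∃ l : ℕ, l ≤ m ∧ ∃ A B : Fin l → Finset (Fin n),
    IsSetComposition A ∧ IsSetComposition B ∧ x = rowToRowSum k B A}

/-- `J_m = 𝒜 · span {∇_U^- | U ⊆ [n], |U| = m + 1} · 𝒜` (a product of `k`-submodules of `𝒜`). -/
noncomputable def idealJ (k : Type*) [CommRing k] (n m : ℕ) : Submodule k (GrpAlg k n) :=
  (⊤ : Submodule k (GrpAlg k n)) *
    Submodule.span k {x | ∃ U : Finset (Fin n), U.card = m + 1 ∧ x = antisymmetrizer k U} *
    (⊤ : Submodule k (GrpAlg k n))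

/-! ### Young tableaux and Specht modules -/

/-- The Young diagram of a partition: its `i`-th row has as many cells as the `i`-th largest
part (cells are pairs `(row, column)`). -/
def diagram {n : ℕ} (lam : n.Partition) : YoungDiagram :=
  YoungDiagram.ofRowLens (lam.parts.sort (· ≥ ·)) (lam.parts.pairwise_sort (· ≥ ·)).sortedGE

/-- A Young tableau of shape `lam`, filled with the elements of `[n]` without repetition
(not necessarily standard). -/
abbrev Tableau {n : ℕ} (lam : n.Partition) : Type :=
  {c : ℕ × ℕ // c ∈ (diagram lam).cells} ≃ Fin n

theorem card_cellsOfRowLens (w : List ℕ) : (YoungDiagram.cellsOfRowLens w).card = w.sum := by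
  induction w with
  | nil => simp [YoungDiagram.cellsOfRowLens]
  | cons a w ih =>
    rw [YoungDiagram.cellsOfRowLens, Finset.card_union_of_disjoint, Finset.card_map, ih]
    · simp
    · rw [Finset.disjoint_left]
      rintro ⟨i, j⟩ h1 h2
      simp only [Finset.mem_product, Finset.mem_singleton, Finset.mem_map] at h1 h2
      obtain ⟨c, -, hc⟩ := h2
      have := congrArg Prod.fst hc
      simp at this
      omega

/-- Every partition `lam` of `n` has a tableau, since its diagram has exactly `n` cells. -/
theorem Tableau.nonempty {n : ℕ} (lam : n.Partition) : Nonempty (Tableau lam) := by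
  refine Fintype.card_eq.mp ?_
  rw [Fintype.card_coe, Fintype.card_fin]
  refine (card_cellsOfRowLens _).trans ?_
  rw [← Multiset.sum_coe, Multiset.sort_eq, lam.parts_sum]

/-- The (index of the) row of `T` that contains the entry `x`. -/
def Tableau.rowOf {n : ℕ} {lam : n.Partition} (T : Tableau lam) (x : Fin n) : ℕ :=
  (T.symm x).1.1

/-- The (index of the) column of `T` that contains the entry `x`. -/
def Tableau.colOf {n : ℕ} {lam : n.Partition} (T : Tableau lam) (x : Fin n) : ℕ :=
  (T.symm x).1.2

/-- The row symmetrizer `a_T`: the sum of all permutations preserving each row of `T`. -/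
noncomputable def rowSymmetrizer (k : Type*) [CommRing k] {n : ℕ} {lam : n.Partition}
    (T : Tableau lam) : GrpAlg k n :=
  ∑ w : Equiv.Perm (Fin n) with ∀ x : Fin n, Tableau.rowOf T (w x) = Tableau.rowOf T x,
    MonoidAlgebra.of k _ w

/-- The column antisymmetrizer `b_T`: the signed sum of all permutations preserving each column
of `T`. -/
noncomputable def colAntisymmetrizer (k : Type*) [CommRing k] {n : ℕ} {lam : n.Partition}
    (T : Tableau lam) : GrpAlg k n :=
  ∑ w : Equiv.Perm (Fin n) with ∀ x : Fin n, Tableau.colOf T (w x) = Tableau.colOf T x,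
    ((Equiv.Perm.sign w : ℤ) : k) • MonoidAlgebra.of k _ w

/-- The Specht module `S^lam = 𝒜 · a_T · b_T`, the left `𝒜`-module generated by the Young
symmetrizer of a tableau `T` of shape `lam`.  (If `n!` is invertible in `k`, then up to
isomorphism it depends only on `lam`, and it is isomorphic to the span of the polytabloids
of shape `lam`.) -/
noncomputable def spechtModule (k : Type*) [CommRing k] {n : ℕ} {lam : n.Partition}
    (T : Tableau lam) : Submodule (GrpAlg k n) (GrpAlg k n) :=
  Submodule.span (GrpAlg k n) {rowSymmetrizer k T * colAntisymmetrizer k T}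

/-! ### The Artin-Wedderburn map -/

/-- The map `AW : 𝒜 → ∏_lam End(S^lam)` sending `a` to the family of its actions
`s ↦ a * s` on the Specht modules. -/
noncomputable def artinWedderburn (k : Type*) [CommRing k] {n : ℕ}
    (T : ∀ lam : n.Partition, Tableau lam) :
    GrpAlg k n →ₐ[k] (∀ lam : n.Partition, Module.End k (spechtModule k (T lam))) :=
  AlgHom.pi fun lam => Algebra.lsmul k k (spechtModule k (T lam))

/-- The subproduct `∏_{i ∈ U} R_i` of a product `∏_i R_i` of rings, as a two-sided ideal: it
consists of the families whose `i`-th entry is `0` for all `i ∉ U`. -/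
def subproduct {ι : Type*} (R : ι → Type*) [∀ i, Ring (R i)] (U : Set ι) :
    TwoSidedIdeal (∀ i, R i) :=
  TwoSidedIdeal.mk' {f | ∀ i, i ∉ U → f i = 0}
    (fun _ _ => rfl)
    (fun hf hg i hi => by simp [hf i hi, hg i hi])
    (fun hf i hi => by simp [hf i hi])
    (fun hf i hi => by simp [hf i hi])
    (fun hf i hi => by simp [hf i hi])

/-- `𝒜_U`: the preimage under `AW` of the subproduct `∏_{lam ∈ U} End(S^lam)`. -/
noncomputable def preimageIdeal (k : Type*) [CommRing k] {n : ℕ}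
    (T : ∀ lam : n.Partition, Tableau lam) (U : Set n.Partition) :
    TwoSidedIdeal (GrpAlg k n) :=
  (subproduct (fun lam => Module.End k (spechtModule k (T lam))) U).comap (artinWedderburn k T)

end SymGroupAlg

/-! Write `e_λ = a_T b_T`. Comparing rows of one tableau with columns of another gives two
relations: `e_λ x e_λ` is a scalar multiple of `e_λ`, and `e_λ x e_μ = 0` for `λ ≠ μ`. Everything
else follows from a decomposition `1 = ∑ p_{λ,w} e_λ w⁻¹` (`exists_sum_youngSymmetrizer_eq_one`).

The decomposition is found over `ℤ`. The sums of conjugates of the `e_λ`, suitably scaled, are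
central, mutually orthogonal quasi-idempotents `y² = d y`. A trace argument
(`dvd_of_mul_self_eq_smul`) shows that `d` divides `n!^3`. The centre has room for only as many such
elements as there are partitions (`card_le_card_partition`), so `n!^3 · 1` minus the appropriate
combination of them must vanish. Base change to `k` then makes `n!^3` invertible.

Given the decomposition, `AW` is bijective by direct construction. A submodule equals `𝒜_U` as soon
as it contains `x e_λ y` for `λ ∈ U` and annihilates `S^λ` for `λ ∉ U` (`coe_eq_preimageIdeal`). For
both ideals this comes from three facts: `a_T` is a row-to-row sum with `ℓ(λ)` blocks; `b_T` is
divisible by `∇_U^-` for some `U` of size `m + 1` in the first column when `ℓ(λ) > m`; and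
row-to-row sums of length at most `m` annihilate such `∇_U^-` on both sides, by pigeonhole. -/

namespace SymGroupAlg

open Finset

/-! ### Combinatorics of tableaux: dominance and transversality. -/

section Tableaux

variable {n : ℕ} {lam mu : n.Partition}

theorem Tableau.mem_diagram (T : Tableau lam) (x : Fin n) :
    (T.rowOf x, T.colOf x) ∈ diagram lam :=
  (T.symm x).2

theorem Tableau.eq_of_rowOf_eq_of_colOf_eq (T : Tableau lam) {x y : Fin n}
    (hr : T.rowOf x = T.rowOf y) (hc : T.colOf x = T.colOf y) : x = y :=
  T.symm.injective (Subtype.ext (Prod.ext hr hc))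

theorem Tableau.exists_of_mem (T : Tableau lam) {i j : ℕ} (h : (i, j) ∈ diagram lam) :
    ∃ x, T.rowOf x = i ∧ T.colOf x = j :=
  ⟨T ⟨(i, j), h⟩, by simp [Tableau.rowOf], by simp [Tableau.colOf]⟩

theorem Tableau.colOf_trans (T : Tableau lam) (w : Equiv.Perm (Fin n)) (x : Fin n) :
    Tableau.colOf (lam := lam) (T.trans w) x = T.colOf (w⁻¹ x) := rfl

theorem Tableau.card_rowOf_lt_colOf_eq (T : Tableau lam) (r j : ℕ) :
    #{x | T.rowOf x < r ∧ T.colOf x = j} = min r ((diagram lam).colLen j) := by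
  rw [← card_range (min r _)]
  refine card_nbij T.rowOf ?_ ?_ ?_
  · intro x hx
    obtain ⟨h1, h2⟩ : T.rowOf x < r ∧ T.colOf x = j := by simpa using hx
    have := YoungDiagram.mem_iff_lt_colLen.1 (T.mem_diagram x)
    simp_all
  · intro x hx y hy h
    simp only [coe_filter, mem_univ, true_and, Set.mem_ofPred_eq] at hx hy
    exact T.eq_of_rowOf_eq_of_colOf_eq h (hx.2.trans hy.2.symm)
  · intro i hi
    simp only [coe_range, Set.mem_Iio, lt_inf_iff] at hi
    obtain ⟨x, hx1, hx2⟩ := T.exists_of_mem (YoungDiagram.mem_iff_lt_colLen.2 hi.2)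
    exact ⟨x, by simp [hx1, hx2, hi.1], hx1⟩

theorem Tableau.card_colOf_eq (T : Tableau lam) (j : ℕ) :
    #{x | T.colOf x = j} = (diagram lam).colLen j := by
  rw [← min_self ((diagram lam).colLen j), ← T.card_rowOf_lt_colOf_eq]
  congr 1
  ext x
  have := YoungDiagram.mem_iff_lt_colLen.1 (T.mem_diagram x)
  simp only [mem_filter, mem_univ, true_and]
  constructor
  · rintro rfl
    exact ⟨this, rfl⟩
  · exact And.right

theorem Tableau.card_rowOf_eq (T : Tableau lam) (i : ℕ) :
    #{x | T.rowOf x = i} = (diagram lam).rowLen i := by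
  rw [← card_range ((diagram lam).rowLen i)]
  refine card_nbij T.colOf ?_ ?_ ?_
  · intro x hx
    obtain rfl : T.rowOf x = i := by simpa using hx
    simpa using YoungDiagram.mem_iff_lt_rowLen.1 (T.mem_diagram x)
  · intro x hx y hy h
    simp only [coe_filter, mem_univ, true_and, Set.mem_ofPred_eq] at hx hy
    exact T.eq_of_rowOf_eq_of_colOf_eq (hx.trans hy.symm) h
  · intro j hj
    obtain ⟨x, hx1, hx2⟩ := T.exists_of_mem (YoungDiagram.mem_iff_lt_rowLen.2 (by simpa using hj))
    exact ⟨x, by simp [hx1], hx2⟩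

/-- The rows of `T` meet the columns of `T'` in at most one entry each. -/
def Tableau.Transversal (T : Tableau lam) (T' : Tableau mu) : Prop :=
  ∀ x y, T.rowOf x = T.rowOf y → T'.colOf x = T'.colOf y → x = y

/-- Within one column of `T'` the row index in `T` is injective, so the left side is bounded both by
`r` and by the column length. The tableau `T'` itself attains the minimum of these bounds. -/
theorem Tableau.Transversal.card_le {T : Tableau lam} {T' : Tableau mu} (h : T.Transversal T')
    (r j : ℕ) :
    #{x | T.rowOf x < r ∧ T'.colOf x = j} ≤ #{x | T'.rowOf x < r ∧ T'.colOf x = j} := by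
  rw [T'.card_rowOf_lt_colOf_eq]
  refine le_min ?_ ?_
  · rw [← card_range r]
    refine card_le_card_of_injOn T.rowOf ?_ ?_
    · intro x hx
      simp_all
    · intro x hx y hy hxy
      simp only [coe_filter, mem_univ, true_and, Set.mem_ofPred_eq] at hx hy
      exact h x y hxy (hx.2.trans hy.2.symm)
  · rw [← T'.card_colOf_eq]
    exact card_le_card fun x hx => by simp_all

theorem Tableau.card_eq_sum_colOf (T' : Tableau mu) (p : Fin n → Prop) [DecidablePred p] :
    #{x | p x} = ∑ j ∈ univ.image T'.colOf, #{x | p x ∧ T'.colOf x = j} := by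
  rw [card_eq_sum_card_fiberwise (f := T'.colOf) (t := univ.image T'.colOf) (by simp [Set.MapsTo])]
  simp [filter_filter]

/-- Summing the columnwise bound over all columns shows that `mu` dominates `lam`. -/
theorem Tableau.Transversal.card_rowOf_lt_le {T : Tableau lam} {T' : Tableau mu}
    (h : T.Transversal T') (r : ℕ) : #{x | T.rowOf x < r} ≤ #{x | T'.rowOf x < r} := by
  rw [T'.card_eq_sum_colOf, T'.card_eq_sum_colOf (fun x => T'.rowOf x < r)]
  exact sum_le_sum fun j _ => h.card_le r j

theorem Tableau.card_rowOf_lt (T T' : Tableau lam) (r : ℕ) :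
    #{x | T.rowOf x < r} = #{x | T'.rowOf x < r} := by
  refine card_bij' (fun x _ => T' (T.symm x)) (fun x _ => T (T'.symm x)) ?_ ?_
    (by simp) (by simp) <;>
  · intro x hx
    rw [mem_filter] at hx ⊢
    simpa [Tableau.rowOf] using hx

theorem diagram_injective : Function.Injective (diagram (n := n)) := by
  intro lam mu h
  have key : ∀ nu : n.Partition, (diagram nu).rowLens = nu.parts.sort (· ≥ ·) := fun nu =>
    YoungDiagram.rowLens_ofRowLens_eq_self fun x hx => nu.parts_pos (by simpa using hx)
  have h1 : lam.parts.sort (· ≥ ·) = mu.parts.sort (· ≥ ·) := by rw [← key, ← key, h]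
  refine Nat.Partition.ext ?_
  rw [← Multiset.sort_eq lam.parts (· ≥ ·), h1, Multiset.sort_eq]

theorem colLen_diagram_zero (lam : n.Partition) :
    (diagram lam).colLen 0 = Multiset.card lam.parts := by
  rw [← YoungDiagram.length_rowLens, diagram, YoungDiagram.rowLens_ofRowLens_eq_self,
    Multiset.length_sort]
  exact fun x hx => lam.parts_pos (by simpa using hx)

theorem eq_of_card_rowOf_lt {T : Tableau lam} {T' : Tableau mu}
    (h : ∀ r, #{x | T.rowOf x < r} = #{x | T'.rowOf x < r}) : lam = mu := by
  have key : ∀ {nu : n.Partition} (S : Tableau nu) (r : ℕ),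
      #{x | S.rowOf x < r + 1} = #{x | S.rowOf x < r} + (diagram nu).rowLen r := by
    intro nu S r
    rw [← S.card_rowOf_eq, ← card_union_of_disjoint]
    · congr 1
      ext x
      simp [le_iff_lt_or_eq]
    · rw [disjoint_left]
      intro x hx hx'
      simp_all
  refine diagram_injective (SetLike.ext fun ⟨i, j⟩ => ?_)
  rw [YoungDiagram.mem_iff_lt_rowLen, YoungDiagram.mem_iff_lt_rowLen]
  have h1 := key T i
  have h2 := key T' i
  have h3 := h i
  have h4 := h (i + 1)
  rw [show (diagram lam).rowLen i = (diagram mu).rowLen i by omega]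

/-- For equal shapes the columnwise bounds have equal totals, so each is an equality. Were the row
of `x` beyond the column's length, the minimum would not grow from `r` to `r + 1`, although `x` is
newly counted. -/
theorem Tableau.Transversal.mem_diagram {T T' : Tableau lam} (h : T.Transversal T') (x : Fin n) :
    (T.rowOf x, T'.colOf x) ∈ diagram lam := by
  have key : ∀ r, #{y | T.rowOf y < r ∧ T'.colOf y = T'.colOf x} =
      min r ((diagram lam).colLen (T'.colOf x)) := by
    intro r
    rw [← T'.card_rowOf_lt_colOf_eq]
    have hsum := T.card_rowOf_lt T' r
    rw [T'.card_eq_sum_colOf, T'.card_eq_sum_colOf (fun x => T'.rowOf x < r)] at hsum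
    exact (sum_eq_sum_iff_of_le fun j _ => h.card_le r j).1 hsum _ (by simp)
  rw [YoungDiagram.mem_iff_lt_colLen]
  by_contra! hlt
  have h1 := key (T.rowOf x)
  have h2 := key (T.rowOf x + 1)
  have h3 : #{y | T.rowOf y < T.rowOf x ∧ T'.colOf y = T'.colOf x} <
      #{y | T.rowOf y < T.rowOf x + 1 ∧ T'.colOf y = T'.colOf x} := by
    refine card_lt_card ((ssubset_iff_of_subset ?_).2 ⟨x, by simp, by simp⟩)
    intro y hy
    simp only [mem_filter, mem_univ, true_and] at hy ⊢
    exact ⟨by omega, hy.2⟩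
  omega

/-- If the rows of `T` are transversal to the columns of `wT`, then `w` is the product of a row
permutation and a column permutation of `T`. -/
theorem Tableau.Transversal.exists_eq_mul {T : Tableau lam} {w : Equiv.Perm (Fin n)}
    (h : T.Transversal (mu := lam) (T.trans w)) :
    ∃ r c : Equiv.Perm (Fin n), (∀ x, T.rowOf (r x) = T.rowOf x) ∧
      (∀ x, T.colOf (c x) = T.colOf x) ∧ w = r * c := by
  let f : Fin n → {c : ℕ × ℕ // c ∈ (diagram lam).cells} := fun x =>
    ⟨(T.rowOf x, Tableau.colOf (lam := lam) (T.trans w) x), h.mem_diagram x⟩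
  have hf : Function.Injective f := fun x y hxy => by
    have := Prod.ext_iff.1 (Subtype.ext_iff.1 hxy)
    exact h x y this.1 this.2
  have hbij : Function.Bijective f :=
    (Fintype.bijective_iff_injective_and_card f).2 ⟨hf, Fintype.card_congr T.symm⟩
  -- `S` is the tableau of shape `lam` with the rows of `T` and the columns of `wT`. The row
  -- permutation `r` carries `T` to `S`, and what remains of `w` preserves the columns of `T`.
  let S : Tableau lam := (Equiv.ofBijective f hbij).symm
  have hSr : ∀ x, S.rowOf x = T.rowOf x := fun x => rfl
  have hSc : ∀ x, S.colOf x = T.colOf (w⁻¹ x) := fun x => rfl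
  let r : Equiv.Perm (Fin n) := T.symm.trans S
  have hr : ∀ x, T.rowOf (r x) = T.rowOf x := fun x => by
    rw [← hSr]
    simp [r, Tableau.rowOf]
  refine ⟨r, r⁻¹ * w, hr, fun x => ?_, by group⟩
  have h1 : ∀ y, T.colOf (r⁻¹ y) = S.colOf y := fun y => by
    have : r⁻¹ = S.symm.trans T := rfl
    rw [this]
    simp [Tableau.colOf]
  rw [Equiv.Perm.mul_apply, h1, hSc]
  simp

end Tableaux

/-! ### Coefficients of the symmetrizers and their behaviour under multiplication by permutations.
-/

section Coefficients

variable {k : Type*} [CommRing k] {n : ℕ}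

theorem coeff_sum_smul_of (P : Equiv.Perm (Fin n) → Prop) [DecidablePred P]
    (f : Equiv.Perm (Fin n) → k) (g : Equiv.Perm (Fin n)) :
    (∑ w with P w, f w • MonoidAlgebra.of k _ w : GrpAlg k n).coeff g = if P g then f g else 0 := by
  rw [MonoidAlgebra.coeff_sum, Finsupp.finsetSum_apply]
  simp [Finsupp.single_apply]

theorem coeff_sum_of (P : Equiv.Perm (Fin n) → Prop) [DecidablePred P] (g : Equiv.Perm (Fin n)) :
    (∑ w with P w, MonoidAlgebra.of k _ w : GrpAlg k n).coeff g = if P g then 1 else 0 := by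
  simpa using coeff_sum_smul_of P (fun _ => (1 : k)) g

theorem coeff_mul_of (x : GrpAlg k n) (g h : Equiv.Perm (Fin n)) :
    (x * MonoidAlgebra.of k _ g).coeff h = x.coeff (h * g⁻¹) := by
  simp

theorem coeff_of_mul (x : GrpAlg k n) (g h : Equiv.Perm (Fin n)) :
    (MonoidAlgebra.of k _ g * x).coeff h = x.coeff (g⁻¹ * h) := by
  simp

@[ext]
theorem GrpAlg.ext_coeff {x y : GrpAlg k n} (h : ∀ g, x.coeff g = y.coeff g) : x = y :=
  MonoidAlgebra.ext (Finsupp.ext h)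

variable {lam : n.Partition} (T : Tableau lam)

theorem coeff_rowSymmetrizer (g : Equiv.Perm (Fin n)) :
    (rowSymmetrizer k T).coeff g = if ∀ x, T.rowOf (g x) = T.rowOf x then 1 else 0 :=
  coeff_sum_of _ g

theorem coeff_colAntisymmetrizer (g : Equiv.Perm (Fin n)) :
    (colAntisymmetrizer k T).coeff g =
      if ∀ x, T.colOf (g x) = T.colOf x then ((Equiv.Perm.sign g : ℤ) : k) else 0 :=
  coeff_sum_smul_of _ _ g

theorem coeff_antisymmetrizer (U : Finset (Fin n)) (g : Equiv.Perm (Fin n)) :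
    (antisymmetrizer k U).coeff g =
      if ∀ i, i ∉ U → g i = i then ((Equiv.Perm.sign g : ℤ) : k) else 0 :=
  coeff_sum_smul_of _ _ g

theorem coeff_rowToRowSum {l : ℕ} (B A : Fin l → Finset (Fin n)) (g : Equiv.Perm (Fin n)) :
    (rowToRowSum k B A).coeff g = if ∀ i, (A i).image (fun x => g x) = B i then 1 else 0 :=
  coeff_sum_of _ g

theorem forall_apply_mul_inv_iff {f : Fin n → ℕ} {g : Equiv.Perm (Fin n)}
    (hg : ∀ x, f (g x) = f x) (h : Equiv.Perm (Fin n)) :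
    (∀ x, f ((h * g⁻¹) x) = f x) ↔ ∀ x, f (h x) = f x := by
  rw [← g.forall_congr_right]
  simp [hg]

theorem forall_apply_inv_mul_iff {f : Fin n → ℕ} {g : Equiv.Perm (Fin n)}
    (hg : ∀ x, f (g x) = f x) (h : Equiv.Perm (Fin n)) :
    (∀ x, f ((g⁻¹ * h) x) = f x) ↔ ∀ x, f (h x) = f x := by
  have : ∀ y, f (g⁻¹ y) = f y := fun y => by simpa using (hg (g⁻¹ y)).symm
  simp only [Equiv.Perm.mul_apply, this]

theorem rowSymmetrizer_mul_of {g : Equiv.Perm (Fin n)} (hg : ∀ x, T.rowOf (g x) = T.rowOf x) :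
    rowSymmetrizer k T * MonoidAlgebra.of k _ g = rowSymmetrizer k T := by
  ext h
  simp only [coeff_mul_of, coeff_rowSymmetrizer, forall_apply_mul_inv_iff hg]

theorem of_mul_rowSymmetrizer {g : Equiv.Perm (Fin n)} (hg : ∀ x, T.rowOf (g x) = T.rowOf x) :
    MonoidAlgebra.of k _ g * rowSymmetrizer k T = rowSymmetrizer k T := by
  ext h
  simp only [coeff_of_mul, coeff_rowSymmetrizer, forall_apply_inv_mul_iff hg]

theorem of_mul_colAntisymmetrizer {g : Equiv.Perm (Fin n)} (hg : ∀ x, T.colOf (g x) = T.colOf x) :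
    MonoidAlgebra.of k _ g * colAntisymmetrizer k T =
      ((Equiv.Perm.sign g : ℤ) : k) • colAntisymmetrizer k T := by
  ext h
  simp only [coeff_of_mul, coeff_colAntisymmetrizer, forall_apply_inv_mul_iff hg,
    MonoidAlgebra.coeff_smul, Finsupp.smul_apply, smul_eq_mul]
  split_ifs <;> simp

theorem colAntisymmetrizer_mul_of {g : Equiv.Perm (Fin n)} (hg : ∀ x, T.colOf (g x) = T.colOf x) :
    colAntisymmetrizer k T * MonoidAlgebra.of k _ g =
      ((Equiv.Perm.sign g : ℤ) : k) • colAntisymmetrizer k T := by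
  ext h
  simp only [coeff_mul_of, coeff_colAntisymmetrizer, forall_apply_mul_inv_iff hg,
    MonoidAlgebra.coeff_smul, Finsupp.smul_apply, smul_eq_mul]
  split_ifs <;> simp [mul_comm]

theorem of_mul_antisymmetrizer {U : Finset (Fin n)} {g : Equiv.Perm (Fin n)}
    (hg : ∀ i, i ∉ U → g i = i) :
    MonoidAlgebra.of k _ g * antisymmetrizer k U =
      ((Equiv.Perm.sign g : ℤ) : k) • antisymmetrizer k U := by
  ext h
  have : (∀ i, i ∉ U → (g⁻¹ * h) i = i) ↔ ∀ i, i ∉ U → h i = i := by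
    refine forall₂_congr fun i hi => ?_
    rw [Equiv.Perm.mul_apply, Equiv.Perm.inv_eq_iff_eq, hg i hi]
  simp only [coeff_of_mul, coeff_antisymmetrizer, this,
    MonoidAlgebra.coeff_smul, Finsupp.smul_apply, smul_eq_mul]
  split_ifs <;> simp

theorem antisymmetrizer_mul_of {U : Finset (Fin n)} {g : Equiv.Perm (Fin n)}
    (hg : ∀ i, i ∉ U → g i = i) :
    antisymmetrizer k U * MonoidAlgebra.of k _ g =
      ((Equiv.Perm.sign g : ℤ) : k) • antisymmetrizer k U := by
  ext h
  have hg' : ∀ i, i ∉ U → g⁻¹ i = i := fun i hi => by rw [Equiv.Perm.inv_eq_iff_eq, hg i hi]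
  have : (∀ i, i ∉ U → (h * g⁻¹) i = i) ↔ ∀ i, i ∉ U → h i = i := by
    refine forall₂_congr fun i hi => ?_
    rw [Equiv.Perm.mul_apply, hg' i hi]
  simp only [coeff_mul_of, coeff_antisymmetrizer, this,
    MonoidAlgebra.coeff_smul, Finsupp.smul_apply, smul_eq_mul]
  split_ifs <;> simp [mul_comm]

theorem of_mul_rowToRowSum {l : ℕ} (B A : Fin l → Finset (Fin n)) (g : Equiv.Perm (Fin n)) :
    MonoidAlgebra.of k _ g * rowToRowSum k B A =
      rowToRowSum k (fun i => (B i).image (fun x => g x)) A := by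
  ext h
  have : ∀ i, (A i).image (fun x => (g⁻¹ * h) x) = B i ↔
      (A i).image (fun x => h x) = (B i).image (fun x => g x) := by
    intro i
    rw [← (image_injective g.injective).eq_iff, image_image]
    simp [Function.comp_def]
  simp only [coeff_of_mul, coeff_rowToRowSum, this]

theorem rowToRowSum_mul_of {l : ℕ} (B A : Fin l → Finset (Fin n)) (g : Equiv.Perm (Fin n)) :
    rowToRowSum k B A * MonoidAlgebra.of k _ g =
      rowToRowSum k B (fun i => (A i).image (fun x => g⁻¹ x)) := by
  ext h
  simp only [coeff_mul_of, coeff_rowToRowSum, image_image, Function.comp_def,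
    Equiv.Perm.mul_apply]
  congr

/-- Inserting `t` in the middle gives `x y = x t y = -x y`. In the applications `t` is a
transposition. -/
theorem mul_eq_zero_of_mul_eq_neg {R : Type*} [Ring R] (h2 : ∀ z : R, z + z = 0 → z = 0)
    {x y t : R} (hx : x * t = x) (hy : t * y = -y) : x * y = 0 := by
  refine h2 _ ?_
  nth_rewrite 1 [← hx]
  rw [mul_assoc, hy, mul_neg, neg_add_cancel]

theorem neg_mul_eq_zero_of_mul_eq {R : Type*} [Ring R] (h2 : ∀ z : R, z + z = 0 → z = 0)
    {x y t : R} (hx : x * t = -x) (hy : t * y = y) : x * y = 0 := by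
  refine h2 _ ?_
  nth_rewrite 1 [← hy]
  rw [← mul_assoc, hx, neg_mul, neg_add_cancel]

theorem exists_mul_mul_eq_smul {x y z : GrpAlg k n}
    (h : ∀ w, ∃ c : k, x * MonoidAlgebra.of k _ w * y = c • z) (a : GrpAlg k n) :
    ∃ c : k, x * a * y = c • z := by
  induction a using MonoidAlgebra.induction_on with
  | of w => exact h w
  | add a b ha hb =>
    obtain ⟨c, hc⟩ := ha
    obtain ⟨d, hd⟩ := hb
    exact ⟨c + d, by rw [mul_add, add_mul, hc, hd, add_smul]⟩
  | smul r a ha =>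
    obtain ⟨c, hc⟩ := ha
    exact ⟨r * c, by rw [mul_smul_comm, smul_mul_assoc, hc, mul_smul]⟩

theorem mul_mul_eq_zero {x y : GrpAlg k n}
    (h : ∀ w, x * MonoidAlgebra.of k _ w * y = 0) (a : GrpAlg k n) : x * a * y = 0 := by
  obtain ⟨c, hc⟩ := exists_mul_mul_eq_smul (z := 0) (fun w => ⟨0, by rw [h w, smul_zero]⟩) a
  simpa using hc

end Coefficients

/-! ### Young symmetrizers: scalar and orthogonality relations. -/

section Young

variable {n : ℕ} {lam mu : n.Partition} {k : Type*} [CommRing k]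

theorem apply_swap_eq {f : Fin n → ℕ} {x y : Fin n} (h : f x = f y) (z : Fin n) :
    f (Equiv.swap x y z) = f z := by
  by_cases hx : z = x
  · simp [hx, h]
  by_cases hy : z = y
  · simp [hy, h]
  rw [Equiv.swap_apply_of_ne_of_ne hx hy]

/-- Two entries sharing a row of `T` and a column of `wT'` give a transposition that is absorbed by
`a_T`, while its conjugate by `w⁻¹` changes the sign of `b_{T'}`. -/
theorem rowSymmetrizer_mul_of_mul_colAntisymmetrizer_eq_zero
    (h2 : ∀ z : GrpAlg k n, z + z = 0 → z = 0) {T : Tableau lam} {T' : Tableau mu}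
    {w : Equiv.Perm (Fin n)} (h : ¬ T.Transversal (mu := mu) (T'.trans w)) :
    rowSymmetrizer k T * MonoidAlgebra.of k _ w * colAntisymmetrizer k T' = 0 := by
  simp only [Tableau.Transversal, not_forall, Tableau.colOf_trans] at h
  obtain ⟨x, y, hr, hc, hne⟩ := h
  rw [mul_assoc]
  refine mul_eq_zero_of_mul_eq_neg h2 (t := MonoidAlgebra.of k _ (Equiv.swap x y))
    (rowSymmetrizer_mul_of T (apply_swap_eq hr)) ?_
  have hs : Equiv.swap x y * w = w * Equiv.swap (w⁻¹ x) (w⁻¹ y) := by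
    rw [Equiv.mul_swap_eq_swap_mul]
    simp
  rw [← mul_assoc, ← map_mul, hs, map_mul, mul_assoc,
    of_mul_colAntisymmetrizer T' (apply_swap_eq hc), Equiv.Perm.sign_swap (by simpa using hne)]
  simp

theorem colAntisymmetrizer_mul_of_mul_rowSymmetrizer_eq_zero
    (h2 : ∀ z : GrpAlg k n, z + z = 0 → z = 0) {T : Tableau lam} {T' : Tableau mu}
    {w : Equiv.Perm (Fin n)} (h : ¬ T.Transversal (mu := mu) (T'.trans w⁻¹)) :
    colAntisymmetrizer k T' * MonoidAlgebra.of k _ w * rowSymmetrizer k T = 0 := by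
  simp only [Tableau.Transversal, not_forall, Tableau.colOf_trans, inv_inv] at h
  obtain ⟨x, y, hr, hc, hne⟩ := h
  rw [mul_assoc]
  refine neg_mul_eq_zero_of_mul_eq h2 (t := MonoidAlgebra.of k _ (Equiv.swap (w x) (w y))) ?_ ?_
  · rw [colAntisymmetrizer_mul_of T' (apply_swap_eq hc), Equiv.Perm.sign_swap (by simpa using hne)]
    simp
  · rw [← mul_assoc, ← map_mul, ← Equiv.mul_swap_eq_swap_mul, map_mul, mul_assoc,
      of_mul_rowSymmetrizer T (apply_swap_eq hr)]

/-- The Young symmetrizer `a_T b_T`. -/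
noncomputable def youngSymmetrizer (k : Type*) [CommRing k] (T : Tableau lam) : GrpAlg k n :=
  rowSymmetrizer k T * colAntisymmetrizer k T

theorem exists_rowSymmetrizer_mul_mul_colAntisymmetrizer
    (h2 : ∀ z : GrpAlg k n, z + z = 0 → z = 0) (T : Tableau lam) (x : GrpAlg k n) :
    ∃ c : k, rowSymmetrizer k T * x * colAntisymmetrizer k T = c • youngSymmetrizer k T := by
  refine exists_mul_mul_eq_smul (fun w => ?_) x
  by_cases h : T.Transversal (mu := lam) (T.trans w)
  · obtain ⟨r, c, hr, hc, rfl⟩ := h.exists_eq_mul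
    refine ⟨((Equiv.Perm.sign c : ℤ) : k), ?_⟩
    rw [map_mul, ← mul_assoc, rowSymmetrizer_mul_of T hr, mul_assoc,
      of_mul_colAntisymmetrizer T hc, mul_smul_comm, youngSymmetrizer]
  · exact ⟨0, by rw [rowSymmetrizer_mul_of_mul_colAntisymmetrizer_eq_zero h2 h, zero_smul]⟩

theorem exists_youngSymmetrizer_mul_mul_self
    (h2 : ∀ z : GrpAlg k n, z + z = 0 → z = 0) (T : Tableau lam) (x : GrpAlg k n) :
    ∃ c : k, youngSymmetrizer k T * x * youngSymmetrizer k T = c • youngSymmetrizer k T := by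
  obtain ⟨c, hc⟩ := exists_rowSymmetrizer_mul_mul_colAntisymmetrizer h2 T
    (colAntisymmetrizer k T * x * rowSymmetrizer k T)
  exact ⟨c, by rw [← hc]; simp only [youngSymmetrizer, mul_assoc]⟩

/-- If the rows of `T'` are transversal to the columns of some translate of `T`, then `lam`
dominates `mu`; antisymmetry of dominance excludes the opposite transversality, so the outer factors
`a_T … b_{T'}` vanish. Otherwise the inner factors `b_T … a_{T'}` vanish. -/
theorem youngSymmetrizer_mul_mul_eq_zero (h2 : ∀ z : GrpAlg k n, z + z = 0 → z = 0)
    (hne : lam ≠ mu) (T : Tableau lam) (T' : Tableau mu) (x : GrpAlg k n) :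
    youngSymmetrizer k T * x * youngSymmetrizer k T' = 0 := by
  by_cases h : ∃ w, T'.Transversal (mu := lam) (T.trans w)
  · obtain ⟨w, hw⟩ := h
    have key : ∀ v, ¬ T.Transversal (mu := mu) (T'.trans v) := fun v hv =>
      hne (eq_of_card_rowOf_lt (T := T) (T' := T') fun r => le_antisymm
        ((hv.card_rowOf_lt_le r).trans_eq (Tableau.card_rowOf_lt _ _ r))
        ((hw.card_rowOf_lt_le r).trans_eq (Tableau.card_rowOf_lt _ _ r)))
    have := mul_mul_eq_zero (x := rowSymmetrizer k T) (y := colAntisymmetrizer k T')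
      (fun v => rowSymmetrizer_mul_of_mul_colAntisymmetrizer_eq_zero h2 (key v))
      (colAntisymmetrizer k T * x * rowSymmetrizer k T')
    simpa only [youngSymmetrizer, mul_assoc] using this
  · have := mul_mul_eq_zero (x := colAntisymmetrizer k T) (y := rowSymmetrizer k T')
      (fun v => colAntisymmetrizer_mul_of_mul_rowSymmetrizer_eq_zero h2
        fun hv => h ⟨v⁻¹, hv⟩) x
    calc _ = rowSymmetrizer k T * (colAntisymmetrizer k T * x * rowSymmetrizer k T') *
          colAntisymmetrizer k T' := by simp only [youngSymmetrizer, mul_assoc]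
      _ = 0 := by rw [this, mul_zero, zero_mul]

theorem coeff_mul_eq_sum (x y : GrpAlg k n) (g : Equiv.Perm (Fin n)) :
    (x * y).coeff g = ∑ w, x.coeff w * y.coeff (w⁻¹ * g) := by
  have : x = ∑ w, x.coeff w • MonoidAlgebra.of k _ w := by
    simpa using GrpAlg.ext_coeff fun g => (coeff_sum_smul_of (fun _ => True) x.coeff g).symm
  conv_lhs => rw [this]
  simp only [sum_mul, MonoidAlgebra.coeff_sum, Finsupp.finsetSum_apply, smul_mul_assoc,
    MonoidAlgebra.coeff_smul, Finsupp.smul_apply, coeff_of_mul, smul_eq_mul]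

/-- A permutation preserving all rows and all columns is trivial, so only one term contributes. In
particular Young symmetrizers are nonzero over `ℤ`. -/
theorem coeff_youngSymmetrizer_one (T : Tableau lam) : (youngSymmetrizer k T).coeff 1 = 1 := by
  rw [youngSymmetrizer, coeff_mul_eq_sum, sum_eq_single 1]
  · simp [coeff_rowSymmetrizer, coeff_colAntisymmetrizer]
  · intro w _ hw
    rw [coeff_rowSymmetrizer, coeff_colAntisymmetrizer]
    split_ifs with h1 h2 <;> try simp
    refine absurd (Equiv.ext fun x => ?_) hw
    exact T.eq_of_rowOf_eq_of_colOf_eq (h1 x) (by simpa using (h2 (w x)).symm)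
  · simp

end Young

/-! ### Integral group algebra: divisibility of the scalars and a resolution of a multiple of the
unit. -/

section Integrality

variable {n : ℕ}

theorem trace_mulLeft {K : Type*} [Field K] (X : GrpAlg K n) :
    LinearMap.trace K (GrpAlg K n) (LinearMap.mulLeft K X) = n.factorial * X.coeff 1 := by
  rw [LinearMap.trace_eq_matrix_trace K (MonoidAlgebra.basis (Equiv.Perm (Fin n)) K), Matrix.trace]
  have : ∀ g : Equiv.Perm (Fin n), Matrix.diag (LinearMap.toMatrix
      (MonoidAlgebra.basis (Equiv.Perm (Fin n)) K) (MonoidAlgebra.basis (Equiv.Perm (Fin n)) K)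
      (LinearMap.mulLeft K X)) g = X.coeff 1 := by
    intro g
    rw [Matrix.diag_apply, LinearMap.toMatrix_apply, MonoidAlgebra.basis_apply,
      LinearMap.mulLeft_apply]
    refine (coeff_mul_of X g g).trans ?_
    rw [mul_inv_cancel]
  rw [sum_congr rfl fun g _ => this g]
  simp [Fintype.card_perm]

/-- If `x ∈ ℤ[S_n]` satisfies `x² = c x` and has a nonzero constant coefficient, then `c` divides
the trace of the multiplication by `x`. -/
theorem dvd_of_mul_self_eq_smul {x : GrpAlg ℤ n} {c : ℤ} (hx : x * x = c • x)
    (h1 : x.coeff 1 ≠ 0) : c ∣ n.factorial * x.coeff 1 := by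
  let φ := MonoidAlgebra.mapRingHom (Equiv.Perm (Fin n)) (Int.castRingHom ℚ)
  have hφ1 : (φ x).coeff 1 = (x.coeff 1 : ℚ) := by simp [φ]
  have hφ : φ x * φ x = (c : ℚ) • φ x := by
    rw [← map_mul, hx, map_zsmul, Int.cast_smul_eq_zsmul]
  have htr := trace_mulLeft (φ x)
  rw [hφ1] at htr
  set L := LinearMap.mulLeft ℚ (φ x) with hL
  have hLL : L * L = (c : ℚ) • L := by
    refine LinearMap.ext fun y => ?_
    rw [Module.End.mul_apply, LinearMap.smul_apply, hL, LinearMap.mulLeft_apply,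
      LinearMap.mulLeft_apply, ← mul_assoc, hφ, smul_mul_assoc]
  have hne : ((n.factorial : ℚ) * (x.coeff 1 : ℚ)) ≠ 0 :=
    mul_ne_zero (by exact_mod_cast n.factorial_ne_zero) (by exact_mod_cast h1)
  -- If `c = 0`, then `L` squares to zero, so its trace would vanish.
  have hc : (c : ℚ) ≠ 0 := by
    intro hc
    rw [hc, zero_smul] at hLL
    have := LinearMap.isNilpotent_trace_of_isNilpotent (f := L) ⟨2, by rw [pow_two, hLL]⟩
    exact hne (htr ▸ this.eq_zero)
  -- The trace of an idempotent is its rank, an integer; this integer is the quotient sought.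
  have hidem : IsIdempotentElem ((c : ℚ)⁻¹ • L) := by
    rw [IsIdempotentElem, smul_mul_smul_comm, hLL, smul_smul, mul_assoc, inv_mul_cancel₀ hc,
      mul_one]
  have h := (LinearMap.IsIdempotentElem.isProj_range _ hidem).trace
  rw [map_smul, htr, smul_eq_mul, inv_mul_eq_iff_eq_mul₀ hc] at h
  exact ⟨_, by exact_mod_cast h⟩

theorem GrpAlg.eq_zero_of_add_self (z : GrpAlg ℤ n) (h : z + z = 0) : z = 0 := by
  ext g
  have := congrArg (fun y : GrpAlg ℤ n => y.coeff g) h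
  simp only [MonoidAlgebra.coeff_add, Finsupp.add_apply, MonoidAlgebra.coeff_zero,
    Finsupp.zero_apply] at this ⊢
  omega

theorem exists_youngSymmetrizer_mul_self {lam : n.Partition} (T : Tableau lam) :
    ∃ κ : ℤ, κ ∣ n.factorial ∧
      youngSymmetrizer ℤ T * youngSymmetrizer ℤ T = κ • youngSymmetrizer ℤ T := by
  obtain ⟨κ, hκ⟩ := exists_youngSymmetrizer_mul_mul_self GrpAlg.eq_zero_of_add_self T 1
  rw [mul_one] at hκ
  refine ⟨κ, ?_, hκ⟩
  have := dvd_of_mul_self_eq_smul hκ (by rw [coeff_youngSymmetrizer_one]; exact one_ne_zero)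
  rwa [coeff_youngSymmetrizer_one, mul_one] at this

/-- A linear map counting coefficients on permutations of each cycle type. -/
noncomputable def cycleTypeSum (n : ℕ) :
    GrpAlg ℤ n →ₗ[ℤ] ((Fintype.card (Fin n)).Partition → ℤ) where
  toFun x p := ∑ w : Equiv.Perm (Fin n) with w.partition = p, x.coeff w
  map_add' x y := by
    ext p
    simp [sum_add_distrib]
  map_smul' c x := by
    ext p
    simp [mul_sum, -zsmul_eq_mul]

/-- A central element is a class function, and cycle type determines the conjugacy class. Each sum
is therefore the class size times the common coefficient. -/
theorem eq_zero_of_cycleTypeSum_eq_zero {x : GrpAlg ℤ n}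
    (hx : ∀ g, MonoidAlgebra.of ℤ _ g * x = x * MonoidAlgebra.of ℤ _ g)
    (h : cycleTypeSum n x = 0) : x = 0 := by
  have hconj : ∀ v w : Equiv.Perm (Fin n), IsConj v w → x.coeff v = x.coeff w := by
    intro v w hvw
    obtain ⟨g, rfl⟩ := isConj_iff.1 hvw
    have := congrArg (fun y : GrpAlg ℤ n => y.coeff (g * v)) (hx g)
    simp only [coeff_of_mul, coeff_mul_of, inv_mul_cancel_left] at this
    exact this
  ext v
  have h1 : ∑ w : Equiv.Perm (Fin n) with w.partition = v.partition, x.coeff w = 0 :=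
    congrFun h v.partition
  rw [sum_congr rfl fun w hw => hconj w v
    (Equiv.Perm.partition_eq_of_isConj.2 (mem_filter.1 hw).2), sum_const, smul_eq_zero] at h1
  rcases h1 with h1 | h1
  · exact absurd h1 (card_ne_zero.2 ⟨v, by simp⟩)
  · simpa using h1

/-- There are at most as many orthogonal central quasi-idempotents as partitions. -/
theorem card_le_card_partition {ι : Type*} [Fintype ι] (v : ι → GrpAlg ℤ n) (d : ι → ℤ)
    (hcentral : ∀ i g, MonoidAlgebra.of ℤ _ g * v i = v i * MonoidAlgebra.of ℤ _ g)
    (horth : ∀ i j, i ≠ j → v i * v j = 0) (hself : ∀ i, v i * v i = d i • v i)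
    (hd : ∀ i, d i ≠ 0) (hv : ∀ i, v i ≠ 0) : Fintype.card ι ≤ Fintype.card n.Partition := by
  classical
  -- A relation among the images lifts to the central elements themselves; multiplying it by `v i`
  -- isolates the `i`-th term.
  have hli : LinearIndependent ℤ (fun i => cycleTypeSum n (v i)) := by
    rw [Fintype.linearIndependent_iff]
    intro g hg i
    have h0 : ∑ j, g j • v j = 0 := by
      refine eq_zero_of_cycleTypeSum_eq_zero (fun w => ?_) (by simpa [-zsmul_eq_mul] using hg)
      simp only [mul_sum, sum_mul, mul_smul_comm, smul_mul_assoc, hcentral]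
    have h1 : (∑ j, g j • v j) * v i = (g i * d i) • v i := by
      rw [sum_mul, sum_eq_single i]
      · rw [smul_mul_assoc, hself, mul_smul]
      · intro j _ hj
        rw [smul_mul_assoc, horth j i hj, smul_zero]
      · simp
    rw [h0, zero_mul] at h1
    obtain ⟨w, hw⟩ : ∃ w, (v i).coeff w ≠ 0 := by
      by_contra! hc
      exact hv i (GrpAlg.ext_coeff (by simpa using hc))
    have h2 := congrArg (fun y : GrpAlg ℤ n => y.coeff w) h1
    simpa [hd i, hw, -zsmul_eq_mul] using h2
  have := hli.fintype_card_le_finrank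
  rw [Module.finrank_fintype_fun_eq_card] at this
  exact this.trans_eq (congrArg (fun m => Fintype.card m.Partition) (Fintype.card_fin n))

/-- The sum of all conjugates of `x`. -/
noncomputable def conjSum (x : GrpAlg ℤ n) : GrpAlg ℤ n :=
  ∑ w, MonoidAlgebra.of ℤ _ w * x * MonoidAlgebra.of ℤ _ w⁻¹

theorem of_mul_conjSum (x : GrpAlg ℤ n) (g : Equiv.Perm (Fin n)) :
    MonoidAlgebra.of ℤ _ g * conjSum x = conjSum x * MonoidAlgebra.of ℤ _ g := by
  rw [conjSum, mul_sum, sum_mul]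
  refine Fintype.sum_equiv (Equiv.mulLeft g) _ _ fun w => ?_
  simp only [Equiv.coe_mulLeft, mul_assoc, ← map_mul, mul_inv_rev, inv_mul_cancel, mul_one]
  rw [← mul_assoc, ← map_mul]

theorem mul_conjSum_comm (x y : GrpAlg ℤ n) : y * conjSum x = conjSum x * y := by
  induction y using MonoidAlgebra.induction_on with
  | of w => exact of_mul_conjSum x w
  | add a b ha hb => rw [add_mul, mul_add, ha, hb]
  | smul r a ha => rw [smul_mul_assoc, mul_smul_comm, ha]

theorem mul_conjSum (x y : GrpAlg ℤ n) :
    conjSum y * conjSum x = conjSum (conjSum y * x) := by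
  conv_lhs => rw [conjSum.eq_def x]
  rw [mul_sum, conjSum.eq_def (conjSum y * x)]
  refine sum_congr rfl fun w _ => ?_
  rw [← mul_assoc, ← mul_assoc, ← of_mul_conjSum, mul_assoc (MonoidAlgebra.of _ _ w)]

theorem conjSum_smul (c : ℤ) (x : GrpAlg ℤ n) : conjSum (c • x) = c • conjSum x := by
  simp only [conjSum, mul_smul_comm, smul_mul_assoc, smul_sum]

theorem coeff_conjSum_one (x : GrpAlg ℤ n) : (conjSum x).coeff 1 = n.factorial * x.coeff 1 := by
  rw [conjSum, MonoidAlgebra.coeff_sum, Finsupp.finsetSum_apply]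
  simp only [coeff_mul_of, coeff_of_mul]
  simp [Fintype.card_perm]

theorem conjSum_mul_conjSum_eq_zero {lam mu : n.Partition} (hne : lam ≠ mu) (T : Tableau lam)
    (T' : Tableau mu) :
    conjSum (youngSymmetrizer ℤ T) * conjSum (youngSymmetrizer ℤ T') = 0 := by
  rw [mul_conjSum]
  suffices h : conjSum (youngSymmetrizer ℤ T) * youngSymmetrizer ℤ T' = 0 by
    rw [h, conjSum]
    simp only [mul_zero, zero_mul, sum_const_zero]
  rw [conjSum, sum_mul]
  refine sum_eq_zero fun w _ => ?_
  have := youngSymmetrizer_mul_mul_eq_zero GrpAlg.eq_zero_of_add_self hne T T'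
    (MonoidAlgebra.of ℤ _ w⁻¹)
  rw [mul_assoc, mul_assoc, ← mul_assoc (youngSymmetrizer ℤ T), this, mul_zero]

/-- With `e² = κ e` and `z` the sum of conjugates of `e`, centrality turns `e z e = d e` into `κ z e
= d e`, and summing conjugates gives `κ z² = d z`. The factor `κ` makes this a quasi-idempotent
relation. The trace bound is `d ∣ n! · κ · n!`, and `κ ∣ n!` accounts for the cube. -/
theorem exists_smul_conjSum_mul_self {lam : n.Partition} (T : Tableau lam) :
    ∃ κ d : ℤ, κ ≠ 0 ∧ d ∣ n.factorial ^ 3 ∧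
      (κ • conjSum (youngSymmetrizer ℤ T)) * (κ • conjSum (youngSymmetrizer ℤ T)) =
        d • (κ • conjSum (youngSymmetrizer ℤ T)) := by
  obtain ⟨κ, hdvd, hκ⟩ := exists_youngSymmetrizer_mul_self T
  have hκ0 : κ ≠ 0 := fun h => by
    rw [h, zero_dvd_iff] at hdvd
    exact n.factorial_ne_zero (by exact_mod_cast hdvd)
  set e := youngSymmetrizer ℤ T
  obtain ⟨d, hd⟩ := exists_youngSymmetrizer_mul_mul_self GrpAlg.eq_zero_of_add_self T (conjSum e)
  have h1 : κ • (conjSum e * e) = d • e := by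
    rw [← hd, mul_conjSum_comm, mul_assoc, hκ, mul_smul_comm]
  have h2 : (κ • conjSum e) * (κ • conjSum e) = d • (κ • conjSum e) := by
    rw [smul_mul_assoc, mul_smul_comm, mul_conjSum, ← conjSum_smul κ (_ * _), h1, conjSum_smul,
      smul_comm]
  refine ⟨κ, d, hκ0, ?_, h2⟩
  have hcoeff : (κ • conjSum e).coeff 1 = κ * n.factorial := by
    rw [MonoidAlgebra.coeff_smul, Finsupp.smul_apply, coeff_conjSum_one,
      coeff_youngSymmetrizer_one, mul_one, smul_eq_mul]
  have h3 := dvd_of_mul_self_eq_smul h2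
    (by rw [hcoeff]; exact mul_ne_zero hκ0 (by exact_mod_cast n.factorial_ne_zero))
  rw [hcoeff] at h3
  refine h3.trans ?_
  rw [show (n.factorial : ℤ) ^ 3 = n.factorial * (n.factorial * n.factorial) by ring]
  exact mul_dvd_mul_left _ (mul_dvd_mul_right hdvd _)

/-- Up to a power of `n!`, the unit of `ℤ[S_n]` is a combination of the central elements attached
to the Young symmetrizers. -/
theorem exists_factorial_pow_smul_one_eq_sum (T : ∀ lam : n.Partition, Tableau lam) :
    ∃ q : n.Partition → ℤ, ((n.factorial : ℤ) ^ 3) • (1 : GrpAlg ℤ n) =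
      ∑ lam, q lam • conjSum (youngSymmetrizer ℤ (T lam)) := by
  choose κ d hκ hd hsq using fun lam => exists_smul_conjSum_mul_self (T lam)
  choose q hq using hd
  set N : ℤ := (n.factorial : ℤ) ^ 3 with hN
  have hN0 : N ≠ 0 := pow_ne_zero _ (by exact_mod_cast n.factorial_ne_zero)
  set y : n.Partition → GrpAlg ℤ n := fun lam => κ lam • conjSum (youngSymmetrizer ℤ (T lam))
    with hy
  have hy_comm : ∀ lam x, x * y lam = y lam * x := fun lam x => by
    simp only [hy, mul_smul_comm, smul_mul_assoc, mul_conjSum_comm]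
  have hy_orth : ∀ lam mu, lam ≠ mu → y lam * y mu = 0 := fun lam mu h => by
    simp only [hy, mul_smul_comm, smul_mul_assoc, conjSum_mul_conjSum_eq_zero h, smul_zero]
  have hy_ne : ∀ lam, y lam ≠ 0 := fun lam h => by
    have := congrArg (fun z : GrpAlg ℤ n => z.coeff 1) h
    simp [hy, coeff_conjSum_one, coeff_youngSymmetrizer_one, hκ, n.factorial_ne_zero,
      -zsmul_eq_mul] at this
  have hd0 : ∀ lam, d lam ≠ 0 := fun lam h => by
    have := hq lam
    rw [h, zero_mul] at this
    exact hN0 this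
  -- Since `N = d q`, each `q y` is `N` times an idempotent over `ℚ`. Hence `u` is `N` times the
  -- complementary idempotent.
  set u : GrpAlg ℤ n := N • 1 - ∑ lam, q lam • y lam with hu
  have hu_comm : ∀ x, x * u = u * x := fun x => by
    simp only [hu, mul_sub, sub_mul, mul_sum, sum_mul, mul_smul_comm, smul_mul_assoc, hy_comm,
      mul_one, one_mul]
  have huy : ∀ lam, u * y lam = 0 := fun lam => by
    rw [hu, sub_mul, sum_mul, sum_eq_single lam]
    · rw [smul_mul_assoc, one_mul, smul_mul_assoc, hsq, smul_smul (q lam), mul_comm (q lam), ← hq, sub_self]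
    · intro mu _ h
      rw [smul_mul_assoc, hy_orth mu lam h, smul_zero]
    · simp
  have huu : u * u = N • u := by
    nth_rewrite 2 [hu]
    simp only [mul_sub, mul_sum, mul_smul_comm, huy, smul_zero, sum_const_zero, sub_zero, mul_one]
  by_cases hu0 : u = 0
  · refine ⟨fun lam => q lam * κ lam, ?_⟩
    rw [sub_eq_zero.1 hu0]
    simp only [hy, mul_smul]
  · exfalso
    -- A nonzero `u` would extend the family `y` to one element more than the number of partitions.
    have := card_le_card_partition (ι := Option n.Partition) (fun i => i.elim u y)
      (fun i => i.elim N d)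
      (by rintro (_ | lam) g; exacts [hu_comm _, hy_comm _ _])
      (by
        rintro (_ | lam) (_ | mu) h
        exacts [absurd rfl h, huy mu, (hu_comm _).trans (huy lam),
          hy_orth lam mu fun h' => h (h' ▸ rfl)])
      (by rintro (_ | lam); exacts [huu, hsq lam])
      (by rintro (_ | lam); exacts [hN0, hd0 lam])
      (by rintro (_ | lam); exacts [hu0, hy_ne lam])
    simp at this

end Integrality

/-! ### Transfer from `ℤ` to `k`. -/

section BaseChange

variable {k : Type*} [CommRing k] {n : ℕ} {lam mu : n.Partition}

/-- The canonical map `ℤ[S_n] → k[S_n]`. -/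
noncomputable def fromInt (k : Type*) [CommRing k] (n : ℕ) : GrpAlg ℤ n →+* GrpAlg k n :=
  MonoidAlgebra.mapRingHom (Equiv.Perm (Fin n)) (Int.castRingHom k)

theorem coeff_fromInt (x : GrpAlg ℤ n) (g : Equiv.Perm (Fin n)) :
    (fromInt k n x).coeff g = (x.coeff g : k) := by
  simp [fromInt]

theorem fromInt_of (g : Equiv.Perm (Fin n)) :
    fromInt k n (MonoidAlgebra.of ℤ _ g) = MonoidAlgebra.of k _ g := by
  simp [fromInt]

theorem fromInt_smul (c : ℤ) (x : GrpAlg ℤ n) :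
    fromInt k n (c • x) = (c : k) • fromInt k n x := by
  rw [map_zsmul, Int.cast_smul_eq_zsmul]

theorem fromInt_youngSymmetrizer (T : Tableau lam) :
    fromInt k n (youngSymmetrizer ℤ T) = youngSymmetrizer k T := by
  have h1 : fromInt k n (rowSymmetrizer ℤ T) = rowSymmetrizer k T := by
    ext g
    rw [coeff_fromInt, coeff_rowSymmetrizer, coeff_rowSymmetrizer]
    split_ifs <;> simp
  have h2 : fromInt k n (colAntisymmetrizer ℤ T) = colAntisymmetrizer k T := by
    ext g
    rw [coeff_fromInt, coeff_colAntisymmetrizer, coeff_colAntisymmetrizer]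
    split_ifs <;> simp
  rw [youngSymmetrizer, map_mul, h1, h2, youngSymmetrizer]

/-- The relation is taken over `ℤ`, where doubling is injective, and pushed forward on group
elements; it thus holds over every `k`, even with 2-torsion. -/
theorem exists_youngSymmetrizer_mul_mul_self_eq_smul (T : Tableau lam) (x : GrpAlg k n) :
    ∃ c : k, youngSymmetrizer k T * x * youngSymmetrizer k T = c • youngSymmetrizer k T := by
  refine exists_mul_mul_eq_smul (fun w => ?_) x
  obtain ⟨c, hc⟩ := exists_youngSymmetrizer_mul_mul_self GrpAlg.eq_zero_of_add_self T
    (MonoidAlgebra.of ℤ _ w)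
  refine ⟨c, ?_⟩
  simpa only [map_mul, fromInt_youngSymmetrizer, fromInt_of, fromInt_smul] using
    congrArg (fromInt k n) hc

theorem youngSymmetrizer_mul_mul_eq_zero_of_ne (hne : lam ≠ mu) (T : Tableau lam)
    (T' : Tableau mu) (x : GrpAlg k n) :
    youngSymmetrizer k T * x * youngSymmetrizer k T' = 0 := by
  refine mul_mul_eq_zero (fun w => ?_) x
  have := congrArg (fromInt k n) (youngSymmetrizer_mul_mul_eq_zero GrpAlg.eq_zero_of_add_self
    hne T T' (MonoidAlgebra.of ℤ _ w))
  simpa only [map_mul, fromInt_youngSymmetrizer, fromInt_of, map_zero] using this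

theorem exists_sum_youngSymmetrizer_eq_one (hn : IsUnit ((Nat.factorial n : ℕ) : k))
    (T : ∀ lam : n.Partition, Tableau lam) :
    ∃ p : n.Partition → Equiv.Perm (Fin n) → GrpAlg k n,
      ∑ lam, ∑ w, p lam w * youngSymmetrizer k (T lam) * MonoidAlgebra.of k _ w⁻¹ = 1 := by
  obtain ⟨q, hq⟩ := exists_factorial_pow_smul_one_eq_sum T
  obtain ⟨N, hN⟩ := hn.pow 3
  have := congrArg (fromInt k n) hq
  simp only [conjSum, map_sum, map_mul, fromInt_youngSymmetrizer, fromInt_of, fromInt_smul,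
    map_one, Int.cast_pow, Int.cast_natCast, ← hN] at this
  refine ⟨fun lam w => (((N⁻¹ : kˣ) : k) * q lam) • MonoidAlgebra.of k _ w, ?_⟩
  have h1 := congrArg (fun y => ((N⁻¹ : kˣ) : k) • y) this
  simp only [smul_smul, Units.inv_mul, one_smul, smul_sum] at h1
  simp only [smul_mul_assoc]
  exact h1.symm

end BaseChange

/-! ### Bijectivity of `AW` and a criterion for the ideals `𝒜_U`. -/

section ArtinWedderburn

variable {k : Type*} [CommRing k] {n : ℕ} (T : ∀ lam : n.Partition, Tableau lam)

theorem mem_spechtModule {lam : n.Partition} {T : Tableau lam} {x : GrpAlg k n} :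
    x ∈ spechtModule k T ↔ ∃ a, a * youngSymmetrizer k T = x :=
  Submodule.mem_span_singleton

theorem artinWedderburn_apply_coe (a : GrpAlg k n) (lam : n.Partition)
    (s : spechtModule k (T lam)) : (artinWedderburn k T a lam s : GrpAlg k n) = a * s := rfl

theorem artinWedderburn_apply_eq_zero_iff (a : GrpAlg k n) (lam : n.Partition) :
    artinWedderburn k T a lam = 0 ↔ ∀ x, a * x * youngSymmetrizer k (T lam) = 0 := by
  constructor
  · intro h x
    have := congrArg Subtype.val
      (LinearMap.congr_fun h ⟨x * youngSymmetrizer k (T lam), mem_spechtModule.2 ⟨x, rfl⟩⟩)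
    rw [artinWedderburn_apply_coe] at this
    rw [mul_assoc, this]
    rfl
  · intro h
    refine LinearMap.ext fun s => Subtype.ext ?_
    obtain ⟨x, hx⟩ := mem_spechtModule.1 s.2
    rw [artinWedderburn_apply_coe, ← hx, ← mul_assoc, h]
    rfl

theorem mem_preimageIdeal (U : Set n.Partition) (a : GrpAlg k n) :
    a ∈ preimageIdeal k T U ↔ ∀ lam ∉ U, ∀ x, a * x * youngSymmetrizer k (T lam) = 0 := by
  rw [preimageIdeal, TwoSidedIdeal.mem_comap, subproduct, TwoSidedIdeal.mem_mk']
  exact forall₂_congr fun lam _ => artinWedderburn_apply_eq_zero_iff T a lam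

theorem mul_eq_sum_of_sum_eq_one {p : n.Partition → Equiv.Perm (Fin n) → GrpAlg k n}
    (hp : ∑ lam, ∑ w, p lam w * youngSymmetrizer k (T lam) * MonoidAlgebra.of k _ w⁻¹ = 1)
    (a : GrpAlg k n) :
    a = ∑ lam, ∑ w, a * p lam w * youngSymmetrizer k (T lam) * MonoidAlgebra.of k _ w⁻¹ := by
  conv_lhs => rw [← mul_one a, ← hp]
  simp only [mul_sum, mul_assoc]

theorem artinWedderburn_bijective (hn : IsUnit ((Nat.factorial n : ℕ) : k)) :
    Function.Bijective (artinWedderburn k T) := by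
  obtain ⟨p, hp⟩ := exists_sum_youngSymmetrizer_eq_one hn T
  constructor
  · rw [injective_iff_map_eq_zero]
    intro a ha
    rw [mul_eq_sum_of_sum_eq_one T hp a]
    refine sum_eq_zero fun lam _ => sum_eq_zero fun w _ => ?_
    rw [(artinWedderburn_apply_eq_zero_iff T a lam).1 (congrFun ha lam), zero_mul]
  · intro f
    have hf : ∀ lam w, ∃ y, y * youngSymmetrizer k (T lam) =
        f lam ⟨p lam w * youngSymmetrizer k (T lam), mem_spechtModule.2 ⟨_, rfl⟩⟩ :=
      fun lam w => mem_spechtModule.1 (f lam _).2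
    choose y hy using hf
    -- The preimage of `f` is the decomposition of `1` with every left factor `p e` replaced by its
    -- image under `f`.
    refine ⟨∑ lam, ∑ w, y lam w * youngSymmetrizer k (T lam) * MonoidAlgebra.of k _ w⁻¹, ?_⟩
    refine funext fun lam => LinearMap.ext fun ⟨s, hs⟩ => Subtype.ext ?_
    rw [artinWedderburn_apply_coe]
    obtain ⟨x, rfl⟩ := mem_spechtModule.1 hs
    choose c hc using fun w : Equiv.Perm (Fin n) =>
      exists_youngSymmetrizer_mul_mul_self_eq_smul (T lam) (MonoidAlgebra.of k _ w⁻¹ * x)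
    -- The scalars `c w` do not depend on `z`. Taking `z = p` expands `s` itself, taking `z = y`
    -- expands the action of the candidate, and linearity of `f` matches the two.
    have key : ∀ z : n.Partition → Equiv.Perm (Fin n) → GrpAlg k n,
        (∑ mu, ∑ w, z mu w * youngSymmetrizer k (T mu) * MonoidAlgebra.of k _ w⁻¹) *
          (x * youngSymmetrizer k (T lam)) =
        ∑ w, c w • (z lam w * youngSymmetrizer k (T lam)) := by
      intro z
      rw [sum_mul, sum_eq_single lam]
      · rw [sum_mul]
        refine sum_congr rfl fun w _ => ?_
        rw [← mul_smul_comm, ← hc]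
        simp only [mul_assoc]
      · intro mu _ hmu
        rw [sum_mul]
        refine sum_eq_zero fun w _ => ?_
        have := youngSymmetrizer_mul_mul_eq_zero_of_ne hmu (T mu) (T lam)
          (MonoidAlgebra.of k _ w⁻¹ * x)
        simp only [mul_assoc] at this ⊢
        rw [this, mul_zero]
      · simp
    have hs' : (⟨x * youngSymmetrizer k (T lam), hs⟩ : spechtModule k (T lam)) =
        ∑ w, c w • ⟨p lam w * youngSymmetrizer k (T lam), mem_spechtModule.2 ⟨_, rfl⟩⟩ := by
      refine Subtype.ext ?_
      rw [AddSubmonoidClass.coe_finsetSum]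
      refine Eq.trans ?_ (key p)
      rw [hp, one_mul]
    rw [key y, hs', map_sum, AddSubmonoidClass.coe_finsetSum]
    refine sum_congr rfl fun w _ => ?_
    rw [map_smul, hy]
    rfl

/-- Expand `a = ∑ a p e_λ w⁻¹`. For `a ∈ 𝒜_U` the terms with `λ ∉ U` vanish and the others lie in
`I`. -/
theorem coe_eq_preimageIdeal (hn : IsUnit ((Nat.factorial n : ℕ) : k))
    {I : Submodule k (GrpAlg k n)} {U : Set n.Partition}
    (hU : ∀ lam ∈ U, ∀ x y, x * youngSymmetrizer k (T lam) * y ∈ I)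
    (hU' : ∀ lam ∉ U, ∀ a ∈ I, ∀ x, a * x * youngSymmetrizer k (T lam) = 0) :
    (I : Set (GrpAlg k n)) = preimageIdeal k T U := by
  ext a
  rw [SetLike.mem_coe, SetLike.mem_coe, mem_preimageIdeal]
  refine ⟨fun ha lam hlam => hU' lam hlam a ha, fun ha => ?_⟩
  obtain ⟨p, hp⟩ := exists_sum_youngSymmetrizer_eq_one hn T
  rw [mul_eq_sum_of_sum_eq_one T hp a]
  refine sum_mem fun lam _ => sum_mem fun w _ => ?_
  by_cases h : lam ∈ U
  · exact hU lam h _ _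
  · rw [ha lam h, zero_mul]
    exact I.zero_mem

end ArtinWedderburn

/-! ### The ideals `I_m` and `J_m`. -/

section Ideals

variable {k : Type*} [CommRing k] {n : ℕ}

/-- Two distinct points force `n ≥ 2`, so 2 divides `n!`; for `n ≤ 1` the element 2 need not be
invertible. -/
theorem GrpAlg.eq_zero_of_add_self_of_isUnit (hn : IsUnit ((Nat.factorial n : ℕ) : k))
    {u v : Fin n} (huv : u ≠ v) (z : GrpAlg k n) (hz : z + z = 0) : z = 0 := by
  have h2 : 2 ∣ n.factorial := Nat.dvd_factorial two_pos (by omega)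
  have hu : IsUnit (2 : k) := isUnit_of_dvd_unit (by exact_mod_cast Nat.cast_dvd_cast h2) hn
  rwa [← two_smul k, hu.smul_eq_zero] at hz

theorem image_swap_eq {s : Finset (Fin n)} {u v : Fin n} (h : u ∈ s ↔ v ∈ s) :
    s.image (fun x => Equiv.swap u v x) = s := by
  refine eq_of_subset_of_card_le (image_subset_iff.2 fun x hx => ?_)
    (card_image_of_injective _ (Equiv.injective _)).ge
  rw [Equiv.swap_apply_def]
  split_ifs with h1 h2
  · exact h.1 (h1 ▸ hx)
  · exact h.2 (h2 ▸ hx)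
  · exact hx

/-- If `U` has more elements than `A` has blocks, some transposition inside `U` preserves all
blocks of `A`. -/
theorem IsSetDecomposition.exists_swap {l : ℕ} {A : Fin l → Finset (Fin n)}
    (hA : IsSetDecomposition A) {U : Finset (Fin n)} (hU : l < U.card) :
    ∃ u ∈ U, ∃ v ∈ U, u ≠ v ∧ ∀ i, (A i).image (fun x => Equiv.swap u v x) = A i := by
  have hblock : ∀ x, ∃ i, x ∈ A i := fun x => by
    have := mem_univ x
    rw [← hA.union] at this
    simpa using this
  choose b hb using hblock
  obtain ⟨u, hu, v, hv, huv, hbuv⟩ := exists_ne_map_eq_of_card_lt_of_maps_to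
    (s := U) (t := univ) (f := b) (by simpa using hU) (by simp [Set.MapsTo])
  have hmem : ∀ x i, x ∈ A i ↔ b x = i := fun x i =>
    ⟨fun h => by_contra fun hne => (disjoint_left.1 (hA.disjoint _ _ hne)) (hb x) h,
      fun h => h ▸ hb x⟩
  exact ⟨u, hu, v, hv, huv, fun i => image_swap_eq (by rw [hmem, hmem, hbuv])⟩

theorem swap_apply_of_notMem {U : Finset (Fin n)} {u v : Fin n} (hu : u ∈ U) (hv : v ∈ U)
    (i : Fin n) (hi : i ∉ U) : Equiv.swap u v i = i :=
  Equiv.swap_apply_of_ne_of_ne (fun h => hi (h ▸ hu)) fun h => hi (h ▸ hv)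

theorem rowToRowSum_mul_antisymmetrizer (hn : IsUnit ((Nat.factorial n : ℕ) : k)) {l : ℕ}
    {A B : Fin l → Finset (Fin n)} (hA : IsSetDecomposition A) {U : Finset (Fin n)}
    (hU : l < U.card) : rowToRowSum k B A * antisymmetrizer k U = 0 := by
  obtain ⟨u, hu, v, hv, huv, h⟩ := hA.exists_swap hU
  refine mul_eq_zero_of_mul_eq_neg (GrpAlg.eq_zero_of_add_self_of_isUnit hn huv)
    (t := MonoidAlgebra.of k _ (Equiv.swap u v)) ?_ ?_
  · simp only [rowToRowSum_mul_of, Equiv.swap_inv, h]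
  · rw [of_mul_antisymmetrizer (swap_apply_of_notMem hu hv), Equiv.Perm.sign_swap huv]
    simp

theorem antisymmetrizer_mul_rowToRowSum (hn : IsUnit ((Nat.factorial n : ℕ) : k)) {l : ℕ}
    {A B : Fin l → Finset (Fin n)} (hB : IsSetDecomposition B) {U : Finset (Fin n)}
    (hU : l < U.card) : antisymmetrizer k U * rowToRowSum k B A = 0 := by
  obtain ⟨u, hu, v, hv, huv, h⟩ := hB.exists_swap hU
  refine neg_mul_eq_zero_of_mul_eq (GrpAlg.eq_zero_of_add_self_of_isUnit hn huv)
    (t := MonoidAlgebra.of k _ (Equiv.swap u v)) ?_ ?_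
  · rw [antisymmetrizer_mul_of (swap_apply_of_notMem hu hv), Equiv.Perm.sign_swap huv]
    simp
  · simp only [of_mul_rowToRowSum, h]

theorem IsSetComposition.image {l : ℕ} {A : Fin l → Finset (Fin n)} (hA : IsSetComposition A)
    (g : Equiv.Perm (Fin n)) : IsSetComposition fun i => (A i).image (fun x => g x) where
  disjoint i j hij := (disjoint_image g.injective).2 (hA.disjoint i j hij)
  union := by
    rw [← biUnion_image (f := fun x => g x), hA.union]
    exact image_univ_of_surjective g.surjective
  nonempty i := (hA.nonempty i).image _

theorem mul_mem_idealI {m : ℕ} {x : GrpAlg k n} (hx : x ∈ idealI k n m) (a : GrpAlg k n) :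
    a * x ∈ idealI k n m := by
  induction a using MonoidAlgebra.induction_on with
  | add a b ha hb => exact add_mul a b x ▸ add_mem ha hb
  | smul r a ha => exact smul_mul_assoc r a x ▸ Submodule.smul_mem _ r ha
  | of g =>
    induction hx using Submodule.span_induction with
    | mem x hx =>
      obtain ⟨l, hl, A, B, hA, hB, rfl⟩ := hx
      rw [of_mul_rowToRowSum]
      exact Submodule.subset_span ⟨l, hl, A, _, hA, hB.image g, rfl⟩
    | zero => exact (mul_zero (MonoidAlgebra.of k _ g)).symm ▸ Submodule.zero_mem _
    | add x y _ _ hx hy => exact mul_add (MonoidAlgebra.of k _ g) x y ▸ add_mem hx hy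
    | smul r x _ hx =>
      exact mul_smul_comm r (MonoidAlgebra.of k _ g) x ▸ Submodule.smul_mem _ r hx

theorem mem_idealI_mul {m : ℕ} {x : GrpAlg k n} (hx : x ∈ idealI k n m) (a : GrpAlg k n) :
    x * a ∈ idealI k n m := by
  induction a using MonoidAlgebra.induction_on with
  | add a b ha hb => exact mul_add x a b ▸ add_mem ha hb
  | smul r a ha => exact mul_smul_comm r x a ▸ Submodule.smul_mem _ r ha
  | of g =>
    induction hx using Submodule.span_induction with
    | mem x hx =>
      obtain ⟨l, hl, A, B, hA, hB, rfl⟩ := hx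
      rw [rowToRowSum_mul_of]
      exact Submodule.subset_span ⟨l, hl, _, B, hA.image g⁻¹, hB, rfl⟩
    | zero => exact (zero_mul (MonoidAlgebra.of k _ g)).symm ▸ Submodule.zero_mem _
    | add x y _ _ hx hy => exact add_mul x y (MonoidAlgebra.of k _ g) ▸ add_mem hx hy
    | smul r x _ hx =>
      exact smul_mul_assoc r x (MonoidAlgebra.of k _ g) ▸ Submodule.smul_mem _ r hx

theorem mul_antisymmetrizer_of_mem_idealI (hn : IsUnit ((Nat.factorial n : ℕ) : k)) {m : ℕ}
    {x : GrpAlg k n} (hx : x ∈ idealI k n m) {U : Finset (Fin n)} (hU : U.card = m + 1) :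
    x * antisymmetrizer k U = 0 := by
  suffices h : idealI k n m ≤ LinearMap.ker (LinearMap.mulRight k (antisymmetrizer k U)) from h hx
  refine Submodule.span_le.2 ?_
  rintro _ ⟨l, hl, A, B, hA, hB, rfl⟩
  exact rowToRowSum_mul_antisymmetrizer hn hA.toIsSetDecomposition (by omega)

theorem antisymmetrizer_mul_of_mem_idealI (hn : IsUnit ((Nat.factorial n : ℕ) : k)) {m : ℕ}
    {x : GrpAlg k n} (hx : x ∈ idealI k n m) {U : Finset (Fin n)} (hU : U.card = m + 1) :
    antisymmetrizer k U * x = 0 := by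
  suffices h : idealI k n m ≤ LinearMap.ker (LinearMap.mulLeft k (antisymmetrizer k U)) from h hx
  refine Submodule.span_le.2 ?_
  rintro _ ⟨l, hl, A, B, hA, hB, rfl⟩
  exact antisymmetrizer_mul_rowToRowSum hn hB.toIsSetDecomposition (by omega)

variable {lam : n.Partition}

theorem rowSymmetrizer_mem_idealI (T : Tableau lam) {m : ℕ}
    (hm : Multiset.card lam.parts ≤ m) : rowSymmetrizer k T ∈ idealI k n m := by
  -- The length of the first column counts the nonempty rows, so the rows form a set composition `A`
  -- and `a_T = ∇_{A,A}`.
  let A : Fin ((diagram lam).colLen 0) → Finset (Fin n) := fun i => {x | T.rowOf x = i}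
  have hlt : ∀ x, T.rowOf x < (diagram lam).colLen 0 := fun x =>
    (YoungDiagram.mem_iff_lt_colLen.1 (T.mem_diagram x)).trans_le
      (YoungDiagram.colLen_anti _ _ _ (Nat.zero_le _))
  have hA : IsSetComposition A :=
    { disjoint := fun i j hij => disjoint_left.2 fun x hi hj => hij <| Fin.ext <| by
        simp only [A, mem_filter, mem_univ, true_and] at hi hj
        exact hi.symm.trans hj
      union := eq_univ_of_forall fun x => mem_biUnion.2 ⟨⟨_, hlt x⟩, mem_univ _, by simp [A]⟩
      nonempty := fun i => by
        obtain ⟨x, hx, -⟩ := T.exists_of_mem (YoungDiagram.mem_iff_lt_colLen.2 i.2)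
        exact ⟨x, by simp [A, hx]⟩ }
  refine Submodule.subset_span ⟨_, (colLen_diagram_zero lam).trans_le hm, A, A, hA, hA, ?_⟩
  ext g
  rw [coeff_rowSymmetrizer, coeff_rowToRowSum]
  refine if_congr ⟨fun h i => ?_, fun h x => ?_⟩ rfl rfl
  · refine eq_of_subset_of_card_le (image_subset_iff.2 fun x hx => ?_)
      (card_image_of_injective _ g.injective).ge
    simpa [A, h] using hx
  · have h1 : g x ∈ (A ⟨_, hlt x⟩).image (fun y => g y) :=
      mem_image_of_mem _ (by simp [A])
    rw [h] at h1
    simpa [A] using h1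

theorem card_perm_fixing (U : Finset (Fin n)) :
    #{w : Equiv.Perm (Fin n) | ∀ i, i ∉ U → w i = i} = U.card.factorial := by
  rw [← Fintype.card_subtype, ← Fintype.card_congr (Equiv.Perm.subtypeEquivSubtypePerm (· ∈ U)),
    Fintype.card_perm, Fintype.card_coe]

/-- Every `w` fixing the complement of `U` is a column permutation of `T`; the two signs cancel, and
each of the `|U|!` terms contributes `b_T`. -/
theorem antisymmetrizer_mul_colAntisymmetrizer (T : Tableau lam) {U : Finset (Fin n)} {j : ℕ}
    (hU : ∀ x ∈ U, T.colOf x = j) :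
    antisymmetrizer k U * colAntisymmetrizer k T =
      ((U.card.factorial : ℕ) : k) • colAntisymmetrizer k T := by
  rw [antisymmetrizer, sum_mul, ← card_perm_fixing U, Nat.cast_smul_eq_nsmul, ← sum_const]
  refine sum_congr rfl fun w hw => ?_
  have hw' : ∀ i, i ∉ U → w i = i := (mem_filter.1 hw).2
  have hcol : ∀ x, T.colOf (w x) = T.colOf x := by
    intro x
    by_cases hx : x ∈ U
    · have : w x ∈ U := by
        by_contra h
        exact h ((w.injective (hw' _ h)).symm ▸ hx)
      rw [hU _ hx, hU _ this]
    · rw [hw' x hx]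
  rw [smul_mul_assoc, of_mul_colAntisymmetrizer T hcol, smul_smul]
  simp [← Int.cast_mul, ← Units.val_mul]

theorem exists_colAntisymmetrizer_eq (hn : IsUnit ((Nat.factorial n : ℕ) : k)) (T : Tableau lam)
    {m : ℕ} (hm : m < Multiset.card lam.parts) :
    ∃ (U : Finset (Fin n)) (c : k), U.card = m + 1 ∧
      colAntisymmetrizer k T = c • (antisymmetrizer k U * colAntisymmetrizer k T) := by
  rw [← colLen_diagram_zero, ← T.card_colOf_eq] at hm
  obtain ⟨U, hU, hcard⟩ := exists_subset_card_eq (Nat.succ_le_of_lt hm)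
  -- Since `|U| ≤ n`, the factorial of `|U|` divides `n!`.
  have hfac : IsUnit ((U.card.factorial : ℕ) : k) :=
    isUnit_of_dvd_unit (Nat.cast_dvd_cast (Nat.factorial_dvd_factorial (card_finset_fin_le U))) hn
  obtain ⟨c, hc⟩ := hfac.exists_left_inv
  refine ⟨U, c, hcard, ?_⟩
  rw [antisymmetrizer_mul_colAntisymmetrizer T (j := 0) (fun x hx => by simpa using hU hx),
    smul_smul, hc, one_smul]

theorem coe_idealI_eq (hn : IsUnit ((Nat.factorial n : ℕ) : k))
    (T : ∀ lam : n.Partition, Tableau lam) (m : ℕ) :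
    (idealI k n m : Set (GrpAlg k n)) =
      preimageIdeal k T {lam | Multiset.card lam.parts ≤ m} := by
  refine coe_eq_preimageIdeal T hn (fun lam hlam x y => ?_) (fun lam hlam a ha x => ?_)
  · rw [youngSymmetrizer, mul_assoc, mul_assoc]
    exact mul_mem_idealI (mem_idealI_mul (rowSymmetrizer_mem_idealI (T lam) hlam) _) _
  · obtain ⟨U, c, hU, hc⟩ := exists_colAntisymmetrizer_eq hn (T lam) (not_le.1 hlam)
    rw [youngSymmetrizer, hc, mul_smul_comm, mul_smul_comm, ← mul_assoc, ← mul_assoc,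
      mul_assoc a x, mul_antisymmetrizer_of_mem_idealI hn (mem_idealI_mul ha _) hU, zero_mul,
      smul_zero]

theorem coe_idealJ_eq (hn : IsUnit ((Nat.factorial n : ℕ) : k))
    (T : ∀ lam : n.Partition, Tableau lam) (m : ℕ) :
    (idealJ k n m : Set (GrpAlg k n)) =
      preimageIdeal k T {lam | Multiset.card lam.parts > m} := by
  refine coe_eq_preimageIdeal T hn (fun lam hlam x y => ?_) (fun lam hlam a ha x => ?_)
  · obtain ⟨U, c, hU, hc⟩ := exists_colAntisymmetrizer_eq hn (T lam) hlam
    have : x * youngSymmetrizer k (T lam) * y = (c • (x * rowSymmetrizer k (T lam))) *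
        antisymmetrizer k U * (colAntisymmetrizer k (T lam) * y) := by
      conv_lhs => rw [youngSymmetrizer, hc]
      simp only [mul_smul_comm, smul_mul_assoc, mul_assoc]
    rw [this]
    exact Submodule.mul_mem_mul (Submodule.mul_mem_mul Submodule.mem_top
      (Submodule.subset_span ⟨U, hU, rfl⟩)) Submodule.mem_top
  · suffices h : idealJ k n m ≤
        LinearMap.ker (LinearMap.mulRight k (x * youngSymmetrizer k (T lam))) by
      rw [mul_assoc]
      exact h ha
    rw [idealJ, mul_assoc]
    refine Submodule.mul_le.2 fun y _ z hz => ?_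
    rw [LinearMap.mem_ker, LinearMap.mulRight_apply, mul_assoc]
    suffices h : z * (x * youngSymmetrizer k (T lam)) = 0 by rw [h, mul_zero]
    refine (Submodule.mul_le (P := LinearMap.ker
      (LinearMap.mulRight k (x * youngSymmetrizer k (T lam))))).2 (fun v hv w _ => ?_) hz
    rw [LinearMap.mem_ker, LinearMap.mulRight_apply, mul_assoc]
    -- Here `ℓ(λ) ≤ m`, so `w x a_T` lies in `I_m`, which antisymmetrizers of size `m + 1`
    -- annihilate from the left.
    suffices h : v * (w * x * rowSymmetrizer k (T lam)) = 0 by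
      rw [youngSymmetrizer, ← mul_assoc w, ← mul_assoc (w * x), ← mul_assoc v, h, zero_mul]
    refine (Submodule.span_le (p := LinearMap.ker
      (LinearMap.mulRight k (w * x * rowSymmetrizer k (T lam))))).2 ?_ hv
    rintro _ ⟨U, hU, rfl⟩
    exact antisymmetrizer_mul_of_mem_idealI hn
      (mul_mem_idealI (rowSymmetrizer_mem_idealI (T lam) (not_lt.1 hlam)) _) hU

end Ideals

end SymGroupAlg

theorem mainTheorem4 (k : Type*) [CommRing k] (n : ℕ) (hn : IsUnit ((Nat.factorial n : ℕ) : k))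
    (T : ∀ lam : n.Partition, SymGroupAlg.Tableau lam) :
    Function.Bijective (SymGroupAlg.artinWedderburn k T) ∧
    ∀ m : ℕ,
      (SymGroupAlg.idealI k n m : Set (SymGroupAlg.GrpAlg k n)) =
        SymGroupAlg.preimageIdeal k T {lam | Multiset.card lam.parts ≤ m} ∧
      (SymGroupAlg.idealJ k n m : Set (SymGroupAlg.GrpAlg k n)) =
        SymGroupAlg.preimageIdeal k T {lam | Multiset.card lam.parts > m} :=
  ⟨SymGroupAlg.artinWedderburn_bijective T hn, fun m =>
    ⟨SymGroupAlg.coe_idealI_eq hn T m, SymGroupAlg.coe_idealJ_eq hn T m⟩⟩
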